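/- Let $\alpha>0$ and let $H$ be a probability distribution on $[0,\infty)$, identified with its distribution function. Let $F$ be a Dirichlet process $\mathrm{DP}(\alpha,H)$, i.e. a random probability measure on $[0,\infty)$ such that for every finite measurable partition $(B_1,\dots,B_k)$ of $[0,\infty)$ the vector $(F(B_1),\dots,F(B_k))$ has the Dirichlet distribution with parameters $(\alpha H(B_1),\dots,\alpha H(B_k))$ (a coordinate with parameter $0$ being almost surely $0$). Let $T_1,T_2,\dots$ be $[0,\infty)$-valued random variables which, conditionally on $F$, are independent with common distribution $F$. Put $S_0=0$, $S_n=T_1+\cdots+T_n$, $N(t)=\sup\{n\ge 0:S_n\le t\}$ and $U(t)=\mathbb E[N(t)]\in[0,\infty]$ for $t\ge 0$. Write $(\alpha)_n=\alpha(\alpha+1)\cdots(\alpha+n-1)$ and, for $j\ge1$, let $H_j$ be the distribution with distribution function $H_j(t)=H(t/j)$; $*$ denotes convolution of distributions, $H_j^{*m}$ the $m$-fold convolution and $H_j^{*0}$ the unit point mass at $0$. Then: (i) for every $n\in\mathbb N$ and $t\ge 0$, $$\mathbb P(S_n\le t)=\frac{n!}{(\alpha)_n}\sum_{v}\left(\prod_{j=1}^n\frac{\alpha^{v_j}}{j^{v_j}\,v_j!}\right)\left(H_1^{*v_1}*H_2^{*v_2}*\cdots*H_n^{*v_n}\right)(t),$$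 where the sum runs over all vectors $v=(v_1,\dots,v_n)$ of non-negative integers with $\sum_{j=1}^n j\,v_j=n$; (ii) for every $t\ge 0$, as an identity in $[0,\infty]$, $$U(t)=\sum_{n=1}^\infty\frac{n!}{(\alpha)_n}\sum_{v}\left(\prod_{j=1}^n\frac{\alpha^{v_j}}{j^{v_j}\,v_j!}\right)\left(H_1^{*v_1}*H_2^{*v_2}*\cdots*H_n^{*v_n}\right)(t),$$ with the inner sum over the same vectors $v$ as in (i). -/

import Mathlib

open MeasureTheory ProbabilityTheory
open scoped NNReal ENNReal Nat

noncomputable section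

/-- The gamma distribution with shape `a ≥ 0` and rate `1`, with the usual convention that shape
`0` means the unit point mass at `0`. -/
def gammaLaw (a : ℝ) : Measure ℝ :=
  if a = 0 then Measure.dirac 0 else gammaMeasure a 1

/-- The Dirichlet distribution with parameters `a i ≥ 0`, not all zero: the law of
`(G i / ∑ l, G l)_i` for independent `G i` with gamma laws of shape `a i` and rate `1`.
Coordinates with parameter `0` vanish. -/
def dirichletLaw {k : ℕ} (a : Fin k → ℝ) : Measure (Fin k → ℝ) :=
  (Measure.pi fun i => gammaLaw (a i)).map fun g i => g i / ∑ l, g l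

/-- `F` is a Dirichlet process with precision `α` and base distribution `H`: a random probability
measure whose values on every finite measurable partition `B` have the Dirichlet distribution with
parameters `α * H (B i)`. -/
structure IsDirichletProcess {Ω S : Type*} [MeasurableSpace Ω] [MeasurableSpace S]
    (F : Ω → ProbabilityMeasure S) (α : ℝ) (H : Measure S) (P : Measure Ω) : Prop where
  measurable : Measurable F
  hasLaw : ∀ (k : ℕ) (B : Fin k → Set S), (∀ i, MeasurableSet (B i)) →
    (∀ i j, i ≠ j → Disjoint (B i) (B j)) → (⋃ i, B i) = Set.univ →
    HasLaw (fun ω i => (F ω : Measure S).real (B i)) (dirichletLaw fun i => α * H.real (B i)) P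

/-- Given the random probability measure `F`, the `T i` are independent with distribution `F`:
`P(T 0 ∈ A 0, …, T (n - 1) ∈ A (n - 1) | F) = F (A 0) ⋯ F (A (n - 1))` almost surely. -/
structure IsCondIID {Ω S : Type*} [MeasurableSpace Ω] [MeasurableSpace S]
    (T : ℕ → Ω → S) (F : Ω → ProbabilityMeasure S) (P : Measure Ω) : Prop where
  measurable : ∀ i, Measurable (T i)
  condProb : ∀ (n : ℕ) (A : Fin n → Set S), (∀ i, MeasurableSet (A i)) →
    P⟦{ω | ∀ i : Fin n, T i ω ∈ A i} | MeasurableSpace.comap F inferInstance⟧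
      =ᵐ[P] fun ω => ∏ i, (F ω : Measure S).real (A i)

/-- The adding process `S_n`, the sum of the first `n` inter-arrival times `T 0, …, T (n - 1)`
(`T i` stands for `T_{i+1}`). -/
def addingProcess {Ω : Type*} (T : ℕ → Ω → ℝ≥0) (n : ℕ) (ω : Ω) : ℝ≥0 :=
  ∑ i ∈ Finset.range n, T i ω

/-- The mixed renewal process `N(t) = sup {n : S_n ≤ t}`, with values in `{0, 1, …, ∞}`. -/
def mixedRenewalProcess {Ω : Type*} (T : ℕ → Ω → ℝ≥0) (t : ℝ≥0) (ω : Ω) : ℕ∞ :=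
  sSup {m : ℕ∞ | ∃ n : ℕ, m = n ∧ addingProcess T n ω ≤ t}

/-- The mixed renewal function `U(t) = E N(t)`, with values in `[0, ∞]`. -/
def mixedRenewalFunction {Ω : Type*} [MeasurableSpace Ω] (P : Measure Ω) (T : ℕ → Ω → ℝ≥0)
    (t : ℝ≥0) : ℝ≥0∞ :=
  ∫⁻ ω, (mixedRenewalProcess T t ω : ℝ≥0∞) ∂P

/-- `H_j`, the law of `j * X` for `X` with law `H`; its distribution function is `t ↦ H(t / j)`,
see `scaledLaw_Iic`. -/
def scaledLaw (H : Measure ℝ≥0) (j : ℕ) : Measure ℝ≥0 :=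
  H.map fun x => (j : ℝ≥0) * x

theorem scaledLaw_Iic (H : Measure ℝ≥0) {j : ℕ} (hj : 1 ≤ j) (t : ℝ≥0) :
    scaledLaw H j (Set.Iic t) = H (Set.Iic (t / j)) := by
  have hj' : (0 : ℝ≥0) < j := by exact_mod_cast hj
  rw [scaledLaw, Measure.map_apply (by fun_prop) measurableSet_Iic]
  congr 1
  ext x
  simp [le_div_iff₀ hj', mul_comm]

/-- The `m`-fold convolution `μ^{*m}`; `μ^{*0}` is the point mass at `0`. -/
def convPow (μ : Measure ℝ≥0) : ℕ → Measure ℝ≥0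
  | 0 => Measure.dirac 0
  | m + 1 => (convPow μ m).conv μ

/-- `H_1^{*v_1} * H_2^{*v_2} * ⋯ * H_n^{*v_n}`; the entry `v j` stands for `v_{j+1}`. -/
def partitionConv (H : Measure ℝ≥0) {n : ℕ} (v : Fin n → ℕ) : Measure ℝ≥0 :=
  (List.ofFn fun j : Fin n => convPow (scaledLaw H (j + 1)) (v j)).foldr Measure.conv
    (Measure.dirac 0)

/-- The vectors `v = (v_1, …, v_n)` of natural numbers with `∑ j v_j = n` (see
`mem_partitionVectors`); the entry `v j` stands for `v_{j+1}`. -/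
def partitionVectors (n : ℕ) : Finset (Fin n → ℕ) :=
  (Fintype.piFinset fun _ => Finset.range (n + 1)).filter fun v => ∑ j, (j.val + 1) * v j = n

theorem mem_partitionVectors {n : ℕ} {v : Fin n → ℕ} :
    v ∈ partitionVectors n ↔ ∑ j, (j.val + 1) * v j = n := by
  simp only [partitionVectors, Finset.mem_filter, Fintype.mem_piFinset, Finset.mem_range,
    and_iff_right_iff_imp]
  intro h i
  have h1 : (i.val + 1) * v i ≤ ∑ j, (j.val + 1) * v j :=
    Finset.single_le_sum (f := fun j : Fin n => (j.val + 1) * v j) (fun _ _ => Nat.zero_le _)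
      (Finset.mem_univ i)
  nlinarith [Nat.zero_le (i.val * v i)]

/-- `(α)_n = α (α + 1) ⋯ (α + n - 1)`. -/
def risingFactorial (α : ℝ) (n : ℕ) : ℝ :=
  ∏ i ∈ Finset.range n, (α + i)

end

/-! If `(D_i)` has the Dirichlet distribution with parameters `(a_i)` and `A = ∑ a_i`, then
`E ∏ D_i ^ m_i = ∏ (a_i)_{m_i} / (A)_n` for `n = ∑ m_i`, so that `(A)_n / n! * E (∑ c_i D_i) ^ n` is
the coefficient of `X ^ n` in `∏ (1 - c_i X) ^ (-a_i) = exp (∑_j p_j X ^ j / j)`, where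
`p_j = ∑ a_i c_i ^ j`. Approximating `f` by simple functions, the `n`-th moment of `∫ f dF` under a
Dirichlet process is therefore `n! / (α)_n` times the cycle index of the symmetric group at
`p_j = α ∫ f ^ j dH`. For `f x = exp (i θ x)` this moment is the characteristic function of `S_n`,
and `∫ f ^ j dH` is that of `H_j`: the law of `S_n` is a mixture of the convolutions of the `H_j`,
and `U(t) = ∑ P(S_n ≤ t)` over `n ≥ 1`. -/

section RisingFactorial

theorem risingFactorial_zero (a : ℝ) : risingFactorial a 0 = 1 := by
  simp [risingFactorial]

theorem risingFactorial_succ (a : ℝ) (m : ℕ) :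
    risingFactorial a (m + 1) = risingFactorial a m * (a + m) :=
  Finset.prod_range_succ _ _

theorem risingFactorial_zero_succ (m : ℕ) : risingFactorial 0 (m + 1) = 0 :=
  Finset.prod_eq_zero (Finset.mem_range.2 m.succ_pos) (by simp)

theorem risingFactorial_pos {a : ℝ} (ha : 0 < a) (m : ℕ) : 0 < risingFactorial a m :=
  Finset.prod_pos fun i _ => by positivity

theorem risingFactorial_nonneg {a : ℝ} (ha : 0 ≤ a) (m : ℕ) : 0 ≤ risingFactorial a m :=
  Finset.prod_nonneg fun i _ => by positivity

theorem Gamma_add_natCast {a : ℝ} (ha : 0 < a) (m : ℕ) :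
    Real.Gamma (a + m) = risingFactorial a m * Real.Gamma a := by
  induction m with
  | zero => simp [risingFactorial_zero]
  | succ m ih =>
    rw [risingFactorial_succ, Nat.cast_succ, ← add_assoc, Real.Gamma_add_one (by positivity), ih]
    ring

end RisingFactorial

section GammaLaw

theorem measurable_gammaPDF (a r : ℝ) : Measurable (gammaPDF a r) :=
  (measurable_gammaPDFReal a r).ennreal_ofReal

theorem gammaPDF_mul_pow_mul_exp {a r s : ℝ} (ha : 0 < a) (hr : 0 < r) (hrs : 0 < r + s) (m : ℕ)
    {x : ℝ} (hx : x ≠ 0) :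
    gammaPDF a r x * ENNReal.ofReal (x ^ m * Real.exp (-(s * x))) =
      ENNReal.ofReal (risingFactorial a m * (r ^ a / (r + s) ^ (a + m))) *
        gammaPDF (a + m) (r + s) x := by
  rcases hx.lt_or_gt with hneg | hpos
  · simp [gammaPDF_of_neg hneg]
  have := Real.Gamma_pos_of_pos ha
  have hR := risingFactorial_pos ha m
  have hpow : x ^ (a + m - 1) = x ^ (a - 1) * x ^ m := by
    rw [← Real.rpow_natCast, ← Real.rpow_add hpos, sub_add_eq_add_sub]
  have hexp : Real.exp (-((r + s) * x)) = Real.exp (-(r * x)) * Real.exp (-(s * x)) := by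
    rw [← Real.exp_add, add_mul, neg_add]
  rw [gammaPDF_of_nonneg hpos.le, gammaPDF_of_nonneg hpos.le,
    ← ENNReal.ofReal_mul (by positivity), ← ENNReal.ofReal_mul (by positivity),
    Gamma_add_natCast ha, hpow, hexp]
  congr 1
  field_simp

theorem lintegral_pow_mul_exp_gammaMeasure {a r s : ℝ} (ha : 0 < a) (hr : 0 < r)
    (hrs : 0 < r + s) (m : ℕ) :
    ∫⁻ x, ENNReal.ofReal (x ^ m * Real.exp (-(s * x))) ∂gammaMeasure a r =
      ENNReal.ofReal (risingFactorial a m * (r ^ a / (r + s) ^ (a + m))) := by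
  have hdensity : ∀ᵐ x : ℝ,
      (gammaPDF a r * fun x => ENNReal.ofReal (x ^ m * Real.exp (-(s * x)))) x =
        ENNReal.ofReal (risingFactorial a m * (r ^ a / (r + s) ^ (a + m))) *
          gammaPDF (a + m) (r + s) x :=
    (Measure.ae_ne volume (0 : ℝ)).mono fun _ hx => gammaPDF_mul_pow_mul_exp ha hr hrs m hx
  rw [gammaMeasure, lintegral_withDensity_eq_lintegral_mul _ (measurable_gammaPDF a r)
    (by fun_prop), lintegral_congr_ae hdensity, lintegral_const_mul _ (measurable_gammaPDF _ _),
    lintegral_gammaPDF_eq_one (by positivity) hrs, mul_one]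

theorem gammaLaw_zero : gammaLaw 0 = Measure.dirac 0 := if_pos rfl

theorem gammaLaw_of_pos {a : ℝ} (ha : 0 < a) : gammaLaw a = gammaMeasure a 1 := if_neg ha.ne'

theorem isProbabilityMeasure_gammaLaw {a : ℝ} (ha : 0 ≤ a) :
    IsProbabilityMeasure (gammaLaw a) := by
  rcases ha.eq_or_lt with rfl | ha
  · rw [gammaLaw_zero]
    infer_instance
  · rw [gammaLaw_of_pos ha]
    exact isProbabilityMeasure_gammaMeasure ha one_pos

theorem gammaLaw_ae_pos {a : ℝ} (ha : 0 < a) : ∀ᵐ x ∂gammaLaw a, 0 < x := by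
  rw [gammaLaw_of_pos ha, gammaMeasure, ae_withDensity_iff (measurable_gammaPDF a 1)]
  filter_upwards [Measure.ae_ne volume (0 : ℝ)] with x hx hpdf
  by_contra! hle
  exact hpdf (gammaPDF_of_neg (hle.lt_of_ne hx))

theorem gammaLaw_ae_nonneg {a : ℝ} (ha : 0 ≤ a) : ∀ᵐ x ∂gammaLaw a, 0 ≤ x := by
  rcases ha.eq_or_lt with rfl | ha
  · simp [gammaLaw_zero]
  · exact (gammaLaw_ae_pos ha).mono fun _ => le_of_lt

theorem lintegral_pow_mul_exp_gammaLaw {a s : ℝ} (ha : 0 ≤ a) (hs : 0 ≤ s) (m : ℕ) :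
    ∫⁻ x, ENNReal.ofReal (x ^ m * Real.exp (-(s * x))) ∂gammaLaw a =
      ENNReal.ofReal (risingFactorial a m / (1 + s) ^ (a + m)) := by
  rcases ha.eq_or_lt with rfl | ha
  · rw [gammaLaw_zero, lintegral_dirac' _ (by fun_prop)]
    rcases m with _ | m
    · simp [risingFactorial_zero]
    · simp [risingFactorial_zero_succ]
  · rw [gammaLaw_of_pos ha, lintegral_pow_mul_exp_gammaMeasure ha one_pos (by positivity),
      Real.one_rpow, mul_one_div]

theorem pow_mul_exp_ae_nonneg_gammaLaw {a : ℝ} (ha : 0 ≤ a) (s : ℝ) (m : ℕ) :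
    0 ≤ᵐ[gammaLaw a] fun x => x ^ m * Real.exp (-(s * x)) :=
  (gammaLaw_ae_nonneg ha).mono fun _ hx => mul_nonneg (pow_nonneg hx m) (Real.exp_pos _).le

theorem integrable_pow_mul_exp_gammaLaw {a s : ℝ} (ha : 0 ≤ a) (hs : 0 ≤ s) (m : ℕ) :
    Integrable (fun x => x ^ m * Real.exp (-(s * x))) (gammaLaw a) := by
  refine ⟨by fun_prop, ?_⟩
  rw [hasFiniteIntegral_iff_ofReal (pow_mul_exp_ae_nonneg_gammaLaw ha s m),
    lintegral_pow_mul_exp_gammaLaw ha hs]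
  exact ENNReal.ofReal_lt_top

theorem integral_pow_mul_exp_gammaLaw {a s : ℝ} (ha : 0 ≤ a) (hs : 0 ≤ s) (m : ℕ) :
    ∫ x, x ^ m * Real.exp (-(s * x)) ∂gammaLaw a =
      risingFactorial a m / (1 + s) ^ (a + m) := by
  have hR := risingFactorial_nonneg ha m
  rw [integral_eq_lintegral_of_nonneg_ae (pow_mul_exp_ae_nonneg_gammaLaw ha s m) (by fun_prop),
    lintegral_pow_mul_exp_gammaLaw ha hs, ENNReal.toReal_ofReal (by positivity)]

section Pi

variable {ι : Type*} [Fintype ι] {a : ι → ℝ}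

theorem isProbabilityMeasure_pi_gammaLaw (ha : ∀ i, 0 ≤ a i) :
    IsProbabilityMeasure (Measure.pi fun i => gammaLaw (a i)) := by
  have := fun i => isProbabilityMeasure_gammaLaw (ha i)
  infer_instance

theorem pi_gammaLaw_ae_nonneg (ha : ∀ i, 0 ≤ a i) :
    ∀ᵐ g ∂Measure.pi fun i => gammaLaw (a i), ∀ i, 0 ≤ g i := by
  have := fun i => isProbabilityMeasure_gammaLaw (ha i)
  exact ae_all_iff.2 fun i => (Measure.tendsto_eval_ae_ae (μ := fun i => gammaLaw (a i))).eventually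
    (gammaLaw_ae_nonneg (ha i))

theorem pi_gammaLaw_ae_sum_pos (ha : ∀ i, 0 ≤ a i) (hpos : 0 < ∑ i, a i) :
    ∀ᵐ g ∂Measure.pi fun i => gammaLaw (a i), 0 < ∑ i, g i := by
  have := fun i => isProbabilityMeasure_gammaLaw (ha i)
  obtain ⟨i, -, hi⟩ := (Finset.sum_pos_iff_of_nonneg fun i _ => ha i).1 hpos
  filter_upwards [pi_gammaLaw_ae_nonneg ha,
    (Measure.tendsto_eval_ae_ae (μ := fun i => gammaLaw (a i)) (i := i)).eventually
      (gammaLaw_ae_pos hi)] with g hg hgi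
  exact Finset.sum_pos' (fun i _ => hg i) ⟨i, Finset.mem_univ i, hgi⟩

theorem lintegral_prod_pow_mul_exp_pi_gammaLaw (ha : ∀ i, 0 ≤ a i) {s : ℝ} (hs : 0 ≤ s)
    (m : ι → ℕ) :
    ∫⁻ g, ENNReal.ofReal ((∏ i, g i ^ m i) * Real.exp (-(s * ∑ i, g i)))
        ∂(Measure.pi fun i => gammaLaw (a i)) =
      ENNReal.ofReal ((∏ i, risingFactorial (a i) (m i)) /
        (1 + s) ^ (∑ i, a i + (∑ i, m i : ℕ))) := by
  have := fun i => isProbabilityMeasure_gammaLaw (ha i)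
  have hfactor (g : ι → ℝ) : (∏ i, g i ^ m i) * Real.exp (-(s * ∑ i, g i)) =
      ∏ i, g i ^ m i * Real.exp (-(s * g i)) := by
    rw [Finset.prod_mul_distrib, ← Real.exp_sum, Finset.mul_sum, Finset.sum_neg_distrib]
  simp only [hfactor]
  rw [← ofReal_integral_eq_lintegral_ofReal
    (Integrable.fintype_prod fun i => integrable_pow_mul_exp_gammaLaw (ha i) hs (m i)),
    integral_fintype_prod_eq_prod fun i x => x ^ m i * Real.exp (-(s * x))]
  · simp only [integral_pow_mul_exp_gammaLaw (ha _) hs]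
    rw [Finset.prod_div_distrib, ← Real.rpow_sum_of_pos (by positivity), Finset.sum_add_distrib,
      Nat.cast_sum]
  · filter_upwards [pi_gammaLaw_ae_nonneg ha] with g hg
    exact Finset.prod_nonneg fun i _ => mul_nonneg (pow_nonneg (hg i) _) (Real.exp_pos _).le

end Pi

end GammaLaw

section InversePower

theorem lintegral_pow_mul_exp_eq_inv_pow {x : ℝ} (hx : 0 < x) (n : ℕ) :
    ∫⁻ s in Set.Ici (0 : ℝ), ENNReal.ofReal (s ^ n / n !) * ENNReal.ofReal (Real.exp (-(s * x))) =
      ENNReal.ofReal (x ^ (n + 1))⁻¹ := by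
  have hdensity : ∀ s ∈ Set.Ici (0 : ℝ),
      ENNReal.ofReal (s ^ n / n !) * ENNReal.ofReal (Real.exp (-(s * x))) =
        ENNReal.ofReal (x ^ (n + 1))⁻¹ * gammaPDF (n + 1) x s := by
    intro s (hs : 0 ≤ s)
    rw [gammaPDF_of_nonneg hs, ← ENNReal.ofReal_mul (by positivity),
      ← ENNReal.ofReal_mul (by positivity), Real.Gamma_nat_eq_factorial, add_sub_cancel_right,
      Real.rpow_natCast, ← Nat.cast_succ, Real.rpow_natCast, mul_comm s x]
    congr 1
    field_simp
  have htotal : ∫⁻ s in Set.Ici (0 : ℝ), gammaPDF (n + 1) x s = 1 := by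
    have hneg : ∫⁻ s in Set.Iio (0 : ℝ), gammaPDF (n + 1) x s = 0 :=
      lintegral_gammaPDF_of_nonpos le_rfl
    have hsplit :=
      lintegral_add_compl (μ := volume) (gammaPDF (n + 1) x) (measurableSet_Ici (a := (0 : ℝ)))
    rwa [Set.compl_Ici, hneg, add_zero, lintegral_gammaPDF_eq_one (by positivity) hx] at hsplit
  rw [setLIntegral_congr_fun measurableSet_Ici hdensity,
    lintegral_const_mul _ (measurable_gammaPDF _ _), htotal, mul_one]

theorem lintegral_mul_inv_pow_eq_lintegral_exp {E : Type*} [MeasurableSpace E] {μ : Measure E}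
    [SFinite μ] {w : E → ℝ≥0∞} (hw : Measurable w) {X : E → ℝ} (hX : Measurable X)
    (hpos : ∀ᵐ x ∂μ, 0 < X x) (n : ℕ) :
    ∫⁻ x, w x * ENNReal.ofReal (X x ^ (n + 1))⁻¹ ∂μ =
      ∫⁻ s in Set.Ici (0 : ℝ), ENNReal.ofReal (s ^ n / n !) *
        ∫⁻ x, w x * ENNReal.ofReal (Real.exp (-(s * X x))) ∂μ := by
  calc ∫⁻ x, w x * ENNReal.ofReal (X x ^ (n + 1))⁻¹ ∂μ
      = ∫⁻ x, (∫⁻ s in Set.Ici (0 : ℝ), ENNReal.ofReal (s ^ n / n !) *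
          (w x * ENNReal.ofReal (Real.exp (-(s * X x))))) ∂μ := by
        refine lintegral_congr_ae (hpos.mono fun _ hx => ?_)
        simp only [mul_left_comm _ (w _)]
        rw [lintegral_const_mul _ (by fun_prop), lintegral_pow_mul_exp_eq_inv_pow hx]
    _ = ∫⁻ s in Set.Ici (0 : ℝ), (∫⁻ x, ENNReal.ofReal (s ^ n / n !) *
          (w x * ENNReal.ofReal (Real.exp (-(s * X x)))) ∂μ) :=
        lintegral_lintegral_swap (by fun_prop)
    _ = _ := lintegral_congr fun s => lintegral_const_mul _ (by fun_prop)

theorem lintegral_pow_mul_inv_one_add_rpow {A : ℝ} (hA : 0 < A) (n : ℕ) :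
    ∫⁻ s in Set.Ici (0 : ℝ), ENNReal.ofReal (s ^ n / n !) *
        ENNReal.ofReal ((1 + s) ^ (A + (n + 1 : ℕ)))⁻¹ =
      ENNReal.ofReal (risingFactorial A (n + 1))⁻¹ := by
  have := isProbabilityMeasure_gammaLaw hA.le
  have hR := risingFactorial_pos hA (n + 1)
  have htilt : ∀ s ∈ Set.Ici (0 : ℝ), ENNReal.ofReal (s ^ n / n !) *
      ∫⁻ x, ENNReal.ofReal (x ^ (n + 1)) * ENNReal.ofReal (Real.exp (-(s * x))) ∂gammaLaw A =
        ENNReal.ofReal (risingFactorial A (n + 1)) * (ENNReal.ofReal (s ^ n / n !) *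
          ENNReal.ofReal ((1 + s) ^ (A + (n + 1 : ℕ)))⁻¹) := by
    intro s (hs : 0 ≤ s)
    simp only [← ENNReal.ofReal_mul' (Real.exp_pos _).le]
    rw [lintegral_pow_mul_exp_gammaLaw hA.le hs, div_eq_mul_inv (risingFactorial A _),
      ENNReal.ofReal_mul hR.le, mul_left_comm]
  have hone : ∫⁻ x, ENNReal.ofReal (x ^ (n + 1)) * ENNReal.ofReal (x ^ (n + 1))⁻¹ ∂gammaLaw A =
      1 := by
    rw [lintegral_congr_ae (g := fun _ => 1), lintegral_one, measure_univ]
    filter_upwards [gammaLaw_ae_pos hA] with x hx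
    rw [← ENNReal.ofReal_mul (by positivity), mul_inv_cancel₀ (by positivity), ENNReal.ofReal_one]
  rw [lintegral_mul_inv_pow_eq_lintegral_exp (X := fun x => x) (by fun_prop) (by fun_prop)
      (gammaLaw_ae_pos hA),
    setLIntegral_congr_fun measurableSet_Ici htilt, lintegral_const_mul _ (by fun_prop)] at hone
  rw [ENNReal.ofReal_inv_of_pos hR]
  exact ENNReal.eq_inv_of_mul_eq_one_left ((mul_comm _ _).trans hone)

end InversePower

section DirichletLaw

variable {k : ℕ} {a : Fin k → ℝ}

theorem measurable_div_sum {ι : Type*} [Fintype ι] :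
    Measurable fun (g : ι → ℝ) i => g i / ∑ l, g l := by fun_prop

theorem isProbabilityMeasure_dirichletLaw (ha : ∀ i, 0 ≤ a i) :
    IsProbabilityMeasure (dirichletLaw a) := by
  have := isProbabilityMeasure_pi_gammaLaw ha
  exact Measure.isProbabilityMeasure_map measurable_div_sum.aemeasurable

theorem dirichletLaw_ae_mem_Icc (ha : ∀ i, 0 ≤ a i) :
    ∀ᵐ p ∂dirichletLaw a, ∀ i, p i ∈ Set.Icc (0 : ℝ) 1 := by
  refine (ae_map_iff measurable_div_sum.aemeasurable (by measurability)).2 ?_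
  filter_upwards [pi_gammaLaw_ae_nonneg ha] with g hg i
  have hsum : 0 ≤ ∑ j, g j := Finset.sum_nonneg fun j _ => hg j
  exact ⟨div_nonneg (hg i) hsum,
    div_le_one_of_le₀ (Finset.single_le_sum (fun j _ => hg j) (Finset.mem_univ i)) hsum⟩

theorem integrable_prod_pow_dirichletLaw (ha : ∀ i, 0 ≤ a i) (m : Fin k → ℕ) :
    Integrable (fun p => ∏ i, p i ^ m i) (dirichletLaw a) := by
  have := isProbabilityMeasure_dirichletLaw ha
  refine Integrable.of_bound (Measurable.aestronglyMeasurable (by fun_prop)) 1 ?_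
  filter_upwards [dirichletLaw_ae_mem_Icc ha] with p hp
  rw [Real.norm_eq_abs, Finset.abs_prod]
  refine Finset.prod_le_one (fun i _ => abs_nonneg _) fun i _ => ?_
  rw [abs_pow, abs_of_nonneg (hp i).1]
  exact pow_le_one₀ (hp i).1 (hp i).2

theorem lintegral_prod_pow_dirichletLaw (ha : ∀ i, 0 ≤ a i) (hpos : 0 < ∑ i, a i)
    (m : Fin k → ℕ) {n : ℕ} (hm : ∑ i, m i = n + 1) :
    ∫⁻ p, ENNReal.ofReal (∏ i, p i ^ m i) ∂dirichletLaw a =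
      ENNReal.ofReal ((∏ i, risingFactorial (a i) (m i)) /
        risingFactorial (∑ i, a i) (n + 1)) := by
  have := isProbabilityMeasure_pi_gammaLaw ha
  have hR : 0 ≤ ∏ i, risingFactorial (a i) (m i) :=
    Finset.prod_nonneg fun i _ => risingFactorial_nonneg (ha i) _
  have hnormalize : ∀ᵐ g ∂Measure.pi fun i => gammaLaw (a i),
      ENNReal.ofReal (∏ i, (g i / ∑ l, g l) ^ m i) =
        ENNReal.ofReal (∏ i, g i ^ m i) * ENNReal.ofReal ((∑ l, g l) ^ (n + 1))⁻¹ := by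
    filter_upwards [pi_gammaLaw_ae_nonneg ha] with g hg
    rw [← ENNReal.ofReal_mul (Finset.prod_nonneg fun i _ => pow_nonneg (hg i) _), ← hm,
      ← Finset.prod_pow_eq_pow_sum, ← div_eq_mul_inv, ← Finset.prod_div_distrib]
    simp only [div_pow]
  have htilt : ∀ s ∈ Set.Ici (0 : ℝ), ENNReal.ofReal (s ^ n / n !) *
      ∫⁻ g, ENNReal.ofReal (∏ i, g i ^ m i) * ENNReal.ofReal (Real.exp (-(s * ∑ l, g l)))
        ∂(Measure.pi fun i => gammaLaw (a i)) =
      ENNReal.ofReal (∏ i, risingFactorial (a i) (m i)) * (ENNReal.ofReal (s ^ n / n !) *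
        ENNReal.ofReal ((1 + s) ^ (∑ i, a i + (n + 1 : ℕ)))⁻¹) := by
    intro s (hs : 0 ≤ s)
    simp only [← ENNReal.ofReal_mul' (Real.exp_pos _).le]
    rw [lintegral_prod_pow_mul_exp_pi_gammaLaw ha hs, hm,
      div_eq_mul_inv (∏ i, risingFactorial _ _), ENNReal.ofReal_mul hR, mul_left_comm]
  rw [dirichletLaw, lintegral_map (by fun_prop) measurable_div_sum, lintegral_congr_ae hnormalize,
    lintegral_mul_inv_pow_eq_lintegral_exp (by fun_prop) (by fun_prop)
      (pi_gammaLaw_ae_sum_pos ha hpos), setLIntegral_congr_fun measurableSet_Ici htilt,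
    lintegral_const_mul _ (by fun_prop), lintegral_pow_mul_inv_one_add_rpow hpos,
    ← ENNReal.ofReal_mul hR, div_eq_mul_inv]

theorem integral_prod_pow_dirichletLaw (ha : ∀ i, 0 ≤ a i) (hpos : 0 < ∑ i, a i)
    (m : Fin k → ℕ) :
    ∫ p, ∏ i, p i ^ m i ∂dirichletLaw a =
      (∏ i, risingFactorial (a i) (m i)) / risingFactorial (∑ i, a i) (∑ i, m i) := by
  rcases hn : ∑ i, m i with _ | n
  · have := isProbabilityMeasure_dirichletLaw ha
    have hm : ∀ i, m i = 0 := by simpa using hn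
    simp [hm, risingFactorial_zero]
  · have hnonneg : 0 ≤ᵐ[dirichletLaw a] fun p => ∏ i, p i ^ m i := by
      filter_upwards [dirichletLaw_ae_mem_Icc ha] with p hp
      exact Finset.prod_nonneg fun i _ => pow_nonneg (hp i).1 _
    rw [integral_eq_lintegral_of_nonneg_ae hnonneg (Measurable.aestronglyMeasurable (by fun_prop)),
      lintegral_prod_pow_dirichletLaw ha hpos m hn, ENNReal.toReal_ofReal]
    exact div_nonneg (Finset.prod_nonneg fun i _ => risingFactorial_nonneg (ha i) _)
      (risingFactorial_pos hpos _).le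

end DirichletLaw

section CycleIndex

open PowerSeries

theorem coeff_prod_eq_sum_piAntidiag {R ι : Type*} [CommSemiring R] [Fintype ι] [DecidableEq ι]
    (f : ι → R⟦X⟧) (d : ℕ) :
    coeff d (∏ i, f i) = ∑ l ∈ Finset.piAntidiag Finset.univ d, ∏ i, coeff (l i) (f i) := by
  rw [coeff_prod]
  exact Finset.sum_equiv Finsupp.equivFunOnFinite (by simp [Finset.mem_finsuppAntidiag])
    fun _ _ => rfl

theorem derivative_prod_of_forall_eq_mul {R ι : Type*} [CommSemiring R] (s : Finset ι)
    {f g : ι → R⟦X⟧} (h : ∀ i ∈ s, derivative R (f i) = f i * g i) :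
    derivative R (∏ i ∈ s, f i) = (∏ i ∈ s, f i) * ∑ i ∈ s, g i := by
  classical
  induction s using Finset.induction_on with
  | empty => simp
  | insert i s hi ih =>
    rw [Finset.prod_insert hi, Finset.sum_insert hi, Derivation.leibniz,
      ih fun j hj => h j (Finset.mem_insert_of_mem hj), h i (Finset.mem_insert_self i s),
      smul_eq_mul, smul_eq_mul]
    ring

theorem derivative_rescale {R : Type*} [CommSemiring R] (c : R) (f : R⟦X⟧) :
    derivative R (rescale c f) = C c * rescale c (derivative R f) := by
  ext n
  rw [coeff_derivative, coeff_rescale, coeff_C_mul, coeff_rescale, coeff_derivative]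
  ring

theorem derivative_expand {R : Type*} [CommRing R] (j : ℕ) (f : R⟦X⟧) :
    derivative R (expand (j + 1) j.succ_ne_zero f) =
      expand (j + 1) j.succ_ne_zero (derivative R f) * (C ((j : R) + 1) * X ^ j) := by
  simp only [expand_apply]
  rw [derivative_subst (HasSubst.X_pow j.succ_ne_zero), derivative_pow, derivative_X]
  simp

theorem coeff_eq_of_derivative_eq_mul {R : Type*} [CommRing R] [IsDomain R] [CharZero R]
    {A B L M : R⟦X⟧} {n : ℕ} (hA : derivative R A = A * L) (hB : derivative R B = B * M)
    (hLM : ∀ j < n, coeff j L = coeff j M) (h0 : coeff 0 A = coeff 0 B) {m : ℕ} (hm : m ≤ n) :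
    coeff m A = coeff m B := by
  induction m using Nat.strong_induction_on with
  | _ m ih =>
    rcases m with _ | m
    · exact h0
    have hconv : coeff m (A * L) = coeff m (B * M) := by
      rw [coeff_mul, coeff_mul]
      refine Finset.sum_congr rfl fun p hp => ?_
      have := Finset.HasAntidiagonal.mem_antidiagonal.1 hp
      rw [ih p.1 (by omega) (by omega), hLM p.2 (by omega)]
    rw [← hA, ← hB, coeff_derivative, coeff_derivative] at hconv
    exact mul_right_cancel₀ (Nat.cast_add_one_ne_zero m) hconv

variable {K : Type*} [Field K]

/-- The binomial series `(1 - c X) ^ (-a)`. -/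
noncomputable def negBinomialSeries (a c : K) : K⟦X⟧ :=
  mk fun m => (ascPochhammer K m).eval a / m ! * c ^ m

/-- The cycle index of the symmetric group on `n` letters, evaluated at `p 1, …, p n`; the vector
`v` records the cycle type with `v j` cycles of length `j + 1`. -/
noncomputable def cycleIndex (n : ℕ) (p : ℕ → K) : K :=
  ∑ v ∈ partitionVectors n, ∏ j : Fin n, (p (j + 1) / ((j : K) + 1)) ^ v j / (v j)!

theorem constantCoeff_negBinomialSeries (a c : K) : constantCoeff (negBinomialSeries a c) = 1 := by
  simp [← coeff_zero_eq_constantCoeff_apply, negBinomialSeries]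

theorem tendsto_cycleIndex [TopologicalSpace K] [IsTopologicalSemiring K] {β : Type*}
    {l : Filter β} {p : β → ℕ → K} {q : ℕ → K}
    (h : ∀ j, Filter.Tendsto (fun i => p i j) l (nhds (q j))) (n : ℕ) :
    Filter.Tendsto (fun i => cycleIndex n (p i)) l (nhds (cycleIndex n q)) :=
  tendsto_finsetSum _ fun _ _ => tendsto_finsetProd _ fun j _ =>
    (((h (j + 1)).div_const _).pow _).div_const _

variable [CharZero K]

/-- The series `exp (q X ^ (j + 1))`. -/
noncomputable def expMonomialSeries (j : ℕ) (q : K) : K⟦X⟧ :=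
  expand (j + 1) j.succ_ne_zero (rescale q (PowerSeries.exp K))

theorem coeff_succ_negBinomialSeries (a c : K) (m : ℕ) :
    coeff (m + 1) (negBinomialSeries a c) * ((m : K) + 1) =
      (a + m) * c * coeff m (negBinomialSeries a c) := by
  have hfact : (m ! : K) ≠ 0 := Nat.cast_ne_zero.2 m.factorial_ne_zero
  have hsucc : (m : K) + 1 ≠ 0 := Nat.cast_add_one_ne_zero m
  simp only [negBinomialSeries, coeff_mk, ascPochhammer_succ_eval, Nat.factorial_succ,
    Nat.cast_mul, Nat.cast_succ]
  field_simp
  ring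

theorem derivative_negBinomialSeries (a c : K) :
    derivative K (negBinomialSeries a c) =
      negBinomialSeries a c * mk fun j => a * c ^ (j + 1) := by
  have hgeom : (mk fun j => a * c ^ (j + 1)) * (1 - C c * X) = C (a * c) := by
    ext n
    rcases n with _ | n
    · simp [mul_sub]
    · rw [mul_sub, mul_one, mul_left_comm, ← mul_assoc, map_sub, coeff_succ_mul_X, coeff_C_mul,
        coeff_mk, coeff_mk, coeff_C, if_neg n.succ_ne_zero]
      ring
  have hode : derivative K (negBinomialSeries a c) * (1 - C c * X) =
      negBinomialSeries a c * C (a * c) := by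
    ext n
    rcases n with _ | n
    · have hzero := coeff_succ_negBinomialSeries a c 0
      rw [← coeff_derivative] at hzero
      simpa [mul_comm, mul_sub] using hzero
    · rw [mul_sub, mul_one, mul_left_comm, ← mul_assoc, map_sub, coeff_succ_mul_X, coeff_C_mul,
        coeff_derivative, coeff_derivative, coeff_mul_C, coeff_succ_negBinomialSeries]
      push_cast
      ring
  have hne : (1 - C c * X : K⟦X⟧) ≠ 0 := fun h => by simpa using congrArg (coeff 0) h
  exact mul_right_cancel₀ hne (by rw [hode, mul_assoc, hgeom])

theorem derivative_expMonomialSeries (j : ℕ) (q : K) :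
    derivative K (expMonomialSeries j q) =
      expMonomialSeries j q * (C (((j : K) + 1) * q) * X ^ j) := by
  rw [expMonomialSeries, derivative_expand, derivative_rescale, derivative_exp,
    map_mul (expand _ _), expand_C, map_mul C]
  ring

theorem coeff_mul_expMonomialSeries (j m : ℕ) (q : K) :
    coeff ((j + 1) * m) (expMonomialSeries j q) = q ^ m / m ! := by
  rw [expMonomialSeries, coeff_expand_mul, coeff_rescale, coeff_exp]
  simp [div_eq_mul_inv]

theorem constantCoeff_expMonomialSeries (j : ℕ) (q : K) :
    constantCoeff (expMonomialSeries j q) = 1 := by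
  simpa using coeff_mul_expMonomialSeries j 0 q

theorem coeff_expMonomialSeries_of_not_dvd {j m : ℕ} (q : K) (h : ¬j + 1 ∣ m) :
    coeff m (expMonomialSeries j q) = 0 :=
  coeff_expand_of_not_dvd _ _ _ h

theorem coeff_prod_expMonomialSeries (n : ℕ) (q : Fin n → K) :
    coeff n (∏ j : Fin n, expMonomialSeries j (q j)) =
      ∑ v ∈ partitionVectors n, ∏ j, q j ^ v j / (v j)! := by
  rw [coeff_prod_eq_sum_piAntidiag]
  symm
  refine Finset.sum_of_injOn (fun v j => (j.val + 1) * v j) ?_ ?_ ?_ ?_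
  · intro v _ w _ h
    funext j
    exact Nat.eq_of_mul_eq_mul_left (Nat.succ_pos j.val) (congrFun h j)
  · intro v hv
    simpa [mem_partitionVectors] using hv
  · intro l hl hnot
    have hl : ∑ j, l j = n := by simpa using hl
    by_contra hne
    have hdvd (j : Fin n) : j.val + 1 ∣ l j := by
      by_contra hj
      exact hne (Finset.prod_eq_zero (Finset.mem_univ j) (coeff_expMonomialSeries_of_not_dvd _ hj))
    choose v hv using hdvd
    refine hnot ⟨v, ?_, funext fun j => (hv j).symm⟩
    exact mem_partitionVectors.2 ((Finset.sum_congr rfl fun j _ => (hv j).symm).trans hl)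
  · intro v _
    exact Finset.prod_congr rfl fun j _ => (coeff_mul_expMonomialSeries _ _ _).symm

/-- Both `∏ i, (1 - c i X) ^ (-a i)` and `∏ j, exp (p_j X ^ j / j)` have the logarithmic derivative
`∑ j, p_j X ^ (j - 1)` below order `n`. -/
theorem coeff_prod_negBinomialSeries {ι : Type*} [Fintype ι] (a c : ι → K) (n : ℕ) :
    coeff n (∏ i, negBinomialSeries (a i) (c i)) = cycleIndex n fun j => ∑ i, a i * c i ^ j := by
  rw [cycleIndex, ← coeff_prod_expMonomialSeries n]
  refine coeff_eq_of_derivative_eq_mul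
    (derivative_prod_of_forall_eq_mul _ fun i _ => derivative_negBinomialSeries (a i) (c i))
    (derivative_prod_of_forall_eq_mul _ fun j _ => derivative_expMonomialSeries _ _) ?_ ?_ le_rfl
  · intro l hl
    simp only [map_sum, coeff_mk, coeff_C_mul, coeff_X_pow]
    rw [Finset.sum_eq_single (⟨l, hl⟩ : Fin n)]
    · have : (l : K) + 1 ≠ 0 := Nat.cast_add_one_ne_zero l
      simp only [if_true, mul_one]
      field_simp
    · intro j _ hj
      rw [if_neg fun h => hj (Fin.ext h.symm), mul_zero]
    · simp
  · simp [map_prod, constantCoeff_negBinomialSeries, constantCoeff_expMonomialSeries]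

theorem ascPochhammer_eval_ofReal {𝕜 : Type*} [RCLike 𝕜] (a : ℝ) (n : ℕ) :
    (ascPochhammer 𝕜 n).eval (a : 𝕜) = (risingFactorial a n : 𝕜) := by
  induction n with
  | zero => simp [risingFactorial_zero]
  | succ n ih =>
    rw [ascPochhammer_succ_eval, ih, risingFactorial_succ]
    push_cast
    rfl

end CycleIndex

section DirichletMean

open Filter Topology

variable {𝕜 : Type*} [RCLike 𝕜]

theorem integral_sum_mul_pow_dirichletLaw {k : ℕ} {a : Fin k → ℝ} (ha : ∀ i, 0 ≤ a i)
    (hpos : 0 < ∑ i, a i) (c : Fin k → 𝕜) (n : ℕ) :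
    ∫ p, (∑ i, c i * (p i : 𝕜)) ^ n ∂dirichletLaw a =
      (n ! : 𝕜) / (risingFactorial (∑ i, a i) n : 𝕜) *
        cycleIndex n fun j => ∑ i, (a i : 𝕜) * c i ^ j := by
  have hexpand (m : Fin k → ℕ) (p : Fin k → ℝ) :
      (Nat.multinomial Finset.univ m : 𝕜) * ∏ i, (c i * (p i : 𝕜)) ^ m i =
        (Nat.multinomial Finset.univ m * ∏ i, c i ^ m i) * ((∏ i, p i ^ m i : ℝ) : 𝕜) := by
    simp only [mul_pow, Finset.prod_mul_distrib, mul_assoc, map_prod, map_pow]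
  rw [← coeff_prod_negBinomialSeries, coeff_prod_eq_sum_piAntidiag, Finset.mul_sum]
  simp only [Finset.sum_pow_eq_sum_piAntidiag, hexpand]
  rw [integral_finsetSum _ fun m _ => (integrable_prod_pow_dirichletLaw ha m).ofReal.const_mul _]
  refine Finset.sum_congr rfl fun m hm => ?_
  have hm : ∑ i, m i = n := by simpa using hm
  have hmultinomial : (∏ i, ((m i)! : 𝕜)) * Nat.multinomial Finset.univ m = (n ! : 𝕜) := by
    rw [← hm, ← Nat.multinomial_spec, Nat.cast_mul, Nat.cast_prod]
  have hfact : (∏ i, ((m i)! : 𝕜)) ≠ 0 :=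
    Finset.prod_ne_zero_iff.2 fun i _ => Nat.cast_ne_zero.2 (m i).factorial_ne_zero
  rw [integral_const_mul, integral_ofReal, integral_prod_pow_dirichletLaw ha hpos, hm,
    ← hmultinomial]
  simp only [negBinomialSeries, PowerSeries.coeff_mk, ascPochhammer_eval_ofReal,
    Finset.prod_mul_distrib, Finset.prod_div_distrib, map_div₀, map_prod]
  field_simp

variable {Ω S : Type*} [MeasurableSpace Ω] [MeasurableSpace S] {P : Measure Ω}
  {F : Ω → ProbabilityMeasure S} {α : ℝ} {H : Measure S} [IsProbabilityMeasure H]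

theorem IsDirichletProcess.integral_sum_mul_pow (hF : IsDirichletProcess F α H P) (hα : 0 < α)
    {k : ℕ} {B : Fin k → Set S} (hB : ∀ i, MeasurableSet (B i))
    (hdisj : Pairwise (Function.onFun Disjoint B)) (hcover : ⋃ i, B i = Set.univ) (c : Fin k → 𝕜)
    (n : ℕ) :
    ∫ ω, (∑ i, c i * ((F ω : Measure S).real (B i) : 𝕜)) ^ n ∂P =
      (n ! : 𝕜) / (risingFactorial α n : 𝕜) *
        cycleIndex n fun j => (α : 𝕜) * ∑ i, (H.real (B i) : 𝕜) * c i ^ j := by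
  have htotal : ∑ i, α * H.real (B i) = α := by
    rw [← Finset.mul_sum, ← measureReal_iUnion_fintype hdisj hB, hcover, probReal_univ, mul_one]
  have hlaw := hF.hasLaw k B hB (fun _ _ h => hdisj h) hcover
  have hmean := integral_sum_mul_pow_dirichletLaw (a := fun i => α * H.real (B i))
    (fun i => by positivity) (by rwa [htotal]) c n
  rw [htotal, ← hlaw.map_eq, integral_map hlaw.aemeasurable
    (Measurable.aestronglyMeasurable (by fun_prop))] at hmean
  simpa only [map_mul, mul_assoc, Finset.mul_sum] using hmean

theorem integral_comp_simpleFunc {β E : Type*} [NormedAddCommGroup E] [NormedSpace ℝ E]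
    [CompleteSpace E] {μ : Measure S} [IsFiniteMeasure μ] (g : SimpleFunc S β) (h : β → E) :
    ∫ x, h (g x) ∂μ = ∑ z ∈ g.range, μ.real (g ⁻¹' {z}) • h z := by
  classical
  have hfiber (x : S) : h (g x) = ∑ z ∈ g.range, (g ⁻¹' {z}).indicator (fun _ => h z) x := by
    simp [Set.indicator_apply]
  simp only [hfiber]
  rw [integral_finsetSum _ fun z _ => (integrable_const _).indicator (g.measurableSet_fiber z)]
  exact Finset.sum_congr rfl fun z _ => integral_indicator_const _ (g.measurableSet_fiber z)

theorem IsDirichletProcess.integral_integral_pow_simpleFunc (hF : IsDirichletProcess F α H P)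
    (hα : 0 < α) (g : SimpleFunc S 𝕜) (n : ℕ) :
    ∫ ω, (∫ x, g x ∂(F ω : Measure S)) ^ n ∂P =
      (n ! : 𝕜) / (risingFactorial α n : 𝕜) *
        cycleIndex n fun j => (α : 𝕜) * ∫ x, g x ^ j ∂H := by
  let e := g.range.equivFin.symm
  have hintegral (μ : Measure S) [IsProbabilityMeasure μ] (j : ℕ) :
      ∫ x, g x ^ j ∂μ = ∑ i, (μ.real (g ⁻¹' {(e i : 𝕜)}) : 𝕜) * (e i : 𝕜) ^ j := by
    rw [integral_comp_simpleFunc g fun z => z ^ j, ← Finset.sum_coe_sort, ← e.sum_comp]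
    simp only [RCLike.real_smul_eq_coe_mul]
  have hintegral_one (ω : Ω) : ∫ x, g x ∂(F ω : Measure S) =
      ∑ i, (e i : 𝕜) * ((F ω : Measure S).real (g ⁻¹' {(e i : 𝕜)}) : 𝕜) := by
    simpa only [pow_one, mul_comm] using hintegral (F ω) 1
  have hdisj : Pairwise (Function.onFun Disjoint fun i => g ⁻¹' {(e i : 𝕜)}) := fun i j hij =>
    Disjoint.preimage _ (Set.disjoint_singleton.2 fun h => hij (e.injective (Subtype.ext h)))
  have hcover : ⋃ i, g ⁻¹' {(e i : 𝕜)} = Set.univ :=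
    Set.eq_univ_of_forall fun x => Set.mem_iUnion.2
      ⟨e.symm ⟨g x, g.mem_range_self x⟩, by simp⟩
  simp only [hintegral_one, hintegral H]
  exact hF.integral_sum_mul_pow hα (fun i => g.measurableSet_fiber _) hdisj hcover _ n

theorem IsDirichletProcess.integral_integral_pow [IsFiniteMeasure P]
    (hF : IsDirichletProcess F α H P) (hα : 0 < α) {f : S → 𝕜} (hf : StronglyMeasurable f) {C : ℝ}
    (hC : ∀ x, ‖f x‖ ≤ C) (n : ℕ) :
    ∫ ω, (∫ x, f x ∂(F ω : Measure S)) ^ n ∂P =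
      (n ! : 𝕜) / (risingFactorial α n : 𝕜) *
        cycleIndex n fun j => (α : 𝕜) * ∫ x, f x ^ j ∂H := by
  let κ : Kernel Ω S := ⟨fun ω => F ω, measurable_subtype_coe.comp hF.measurable⟩
  let g := hf.approxBounded C
  have hlim (x : S) : Tendsto (g · x) atTop (𝓝 (f x)) :=
    hf.tendsto_approxBounded_of_norm_le (hC x)
  have := nonempty_of_isProbabilityMeasure H
  have hnonneg : 0 ≤ C := (norm_nonneg _).trans (hC (Classical.arbitrary S))
  have hbound (m : ℕ) (x : S) : ‖g m x‖ ≤ C := hf.norm_approxBounded_le hnonneg m x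
  have hintegral (μ : Measure S) [IsProbabilityMeasure μ] (j : ℕ) :
      Tendsto (fun m => ∫ x, g m x ^ j ∂μ) atTop (𝓝 (∫ x, f x ^ j ∂μ)) := by
    refine tendsto_integral_filter_of_norm_le_const (.of_forall fun m => ?_)
      ⟨C ^ j, .of_forall fun m => .of_forall fun x => ?_⟩ (.of_forall fun x => (hlim x).pow j)
    · exact ((g m).stronglyMeasurable.pow j).aestronglyMeasurable
    · rw [norm_pow]
      exact pow_le_pow_left₀ (norm_nonneg _) (hbound m x) j
  have hmean : Tendsto (fun m => ∫ ω, (∫ x, g m x ∂(F ω : Measure S)) ^ n ∂P) atTop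
      (𝓝 (∫ ω, (∫ x, f x ∂(F ω : Measure S)) ^ n ∂P)) := by
    refine tendsto_integral_filter_of_norm_le_const (.of_forall fun m => ?_)
      ⟨C ^ n, .of_forall fun m => .of_forall fun ω => ?_⟩ (.of_forall fun ω => ?_)
    · exact ((g m).stronglyMeasurable.integral_kernel (κ := κ)).pow n |>.aestronglyMeasurable
    · rw [norm_pow]
      refine pow_le_pow_left₀ (norm_nonneg _) ?_ n
      simpa using norm_integral_le_of_norm_le_const (μ := (F ω : Measure S))
        (.of_forall (hbound m))
    · simpa only [pow_one] using (hintegral (F ω) 1).pow n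
  refine tendsto_nhds_unique hmean ?_
  simp only [hF.integral_integral_pow_simpleFunc hα]
  exact (tendsto_cycleIndex (fun j => (hintegral H j).const_mul _) n).const_mul _

end DirichletMean

section CondIID

variable {Ω S : Type*} [MeasurableSpace Ω] [MeasurableSpace S] {P : Measure Ω}
  {F : Ω → ProbabilityMeasure S} {T : ℕ → Ω → S}

theorem measurable_pi_probabilityMeasure {ι : Type*} [Fintype ι] (hF : Measurable F) :
    Measurable fun ω => Measure.pi fun _ : ι => (F ω : Measure S) := by
  refine Measurable.measure_of_isPiSystem_of_isProbabilityMeasure generateFrom_pi.symm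
    isPiSystem_pi ?_
  rintro _ ⟨A, hA, rfl⟩
  simp only [Measure.pi_pi]
  exact Finset.measurable_prod _ fun i _ => (Measure.measurable_coe (hA i (Set.mem_univ i))).comp
    (measurable_subtype_coe.comp hF)

/-- The conditional law of `n` independent draws from the random probability measure `F`. -/
noncomputable def sampleKernel (hF : Measurable F) (n : ℕ) : Kernel Ω (Fin n → S) :=
  ⟨fun ω => Measure.pi fun _ => (F ω : Measure S), measurable_pi_probabilityMeasure hF⟩

theorem sampleKernel_apply (hF : Measurable F) (n : ℕ) (ω : Ω) :
    sampleKernel hF n ω = Measure.pi fun _ => (F ω : Measure S) := rfl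

instance isMarkovKernel_sampleKernel (hF : Measurable F) (n : ℕ) :
    IsMarkovKernel (sampleKernel hF n) :=
  ⟨fun _ => inferInstanceAs (IsProbabilityMeasure (Measure.pi _))⟩

theorem IsCondIID.measurable_sample (hT : IsCondIID T F P) (n : ℕ) :
    Measurable fun ω (i : Fin n) => T i ω :=
  measurable_pi_lambda _ fun i => hT.measurable i

variable [IsFiniteMeasure P]

theorem IsCondIID.measureReal_forall_mem (hT : IsCondIID T F P) (hF : Measurable F) {n : ℕ}
    {A : Fin n → Set S} (hA : ∀ i, MeasurableSet (A i)) :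
    P.real {ω | ∀ i : Fin n, T i ω ∈ A i} = ∫ ω, ∏ i, (F ω : Measure S).real (A i) ∂P := by
  have hmeas : MeasurableSet {ω | ∀ i : Fin n, T i ω ∈ A i} := by
    rw [Set.ofPred_forall]
    exact MeasurableSet.iInter fun i => hT.measurable i (hA i)
  rw [← integral_congr_ae (hT.condProb n A hA), integral_condExp hF.comap_le,
    integral_indicator_const _ hmeas, smul_eq_mul, mul_one]

theorem IsCondIID.map_eq_sampleKernel_comp (hT : IsCondIID T F P) (hF : Measurable F) (n : ℕ) :
    P.map (fun ω (i : Fin n) => T i ω) = sampleKernel hF n ∘ₘ P := by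
  have hmeas := hT.measurable_sample n
  refine ext_of_generate_finite _ generateFrom_pi.symm isPiSystem_pi ?_
    (by simp [Measure.map_apply hmeas .univ])
  rintro _ ⟨A, hA, rfl⟩
  have hbox : MeasurableSet (Set.univ.pi A) := .univ_pi fun i => hA i (Set.mem_univ i)
  have hpreimage : (fun ω (i : Fin n) => T i ω) ⁻¹' Set.univ.pi A =
      {ω | ∀ i : Fin n, T i ω ∈ A i} := by
    ext ω
    simp
  rw [← measureReal_eq_measureReal_iff, map_measureReal_apply hmeas hbox, hpreimage,
    hT.measureReal_forall_mem hF fun i => hA i (Set.mem_univ i), measureReal_def,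
    Measure.bind_apply hbox (sampleKernel hF n).aemeasurable, ← integral_toReal
      ((sampleKernel hF n).measurable_coe hbox).aemeasurable
      (.of_forall fun _ => measure_lt_top _ _)]
  simp only [sampleKernel_apply, Measure.pi_pi, ENNReal.toReal_prod, measureReal_def]

theorem IsCondIID.integral_prod {𝕜 : Type*} [RCLike 𝕜] (hT : IsCondIID T F P) (hF : Measurable F)
    {n : ℕ} {f : Fin n → S → 𝕜} (hf : ∀ i, StronglyMeasurable (f i))
    (hintegrable : Integrable (fun ω => ∏ i, f i (T i ω)) P) :
    ∫ ω, ∏ i, f i (T i ω) ∂P = ∫ ω, ∏ i, ∫ x, f i x ∂(F ω : Measure S) ∂P := by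
  let κ := sampleKernel hF n
  have hlaw := hT.map_eq_sampleKernel_comp hF n
  have hmeas := (hT.measurable_sample n).aemeasurable (μ := P)
  have hprod : StronglyMeasurable fun x : Fin n → S => ∏ i, f i (x i) :=
    Finset.stronglyMeasurable_fun_prod _ fun i _ => (hf i).comp_measurable (measurable_pi_apply i)
  have hintegrable_comp : Integrable (fun x => ∏ i, f i (x i)) (κ ∘ₘ P) :=
    hlaw ▸ (integrable_map_measure hprod.aestronglyMeasurable hmeas).2 hintegrable
  rw [Measure.comp_eq_comp_const_apply] at hintegrable_comp hlaw
  calc ∫ ω, ∏ i, f i (T i ω) ∂P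
      = ∫ x, ∏ i, f i (x i) ∂(P.map fun ω (i : Fin n) => T i ω) :=
        (integral_map hmeas hprod.aestronglyMeasurable).symm
    _ = ∫ ω, ∫ x, ∏ i, f i (x i) ∂κ ω ∂P := by
        rw [hlaw, Kernel.integral_comp hintegrable_comp, Kernel.const_apply]
    _ = ∫ ω, ∏ i, ∫ x, f i x ∂(F ω : Measure S) ∂P := by
        simp only [κ, sampleKernel_apply, integral_fintype_prod_eq_prod]

end CondIID

section CharFun

/-- The characteristic function of a distribution on `[0, ∞)`. -/
noncomputable def nnCharFun (μ : Measure ℝ≥0) (θ : ℝ) : ℂ :=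
  charFun (μ.map ((↑) : ℝ≥0 → ℝ)) θ

theorem nnCharFun_eq_integral (μ : Measure ℝ≥0) (θ : ℝ) :
    nnCharFun μ θ = ∫ x : ℝ≥0, Complex.exp (θ * (x : ℝ) * Complex.I) ∂μ := by
  rw [nnCharFun, charFun_apply_real, integral_map (by fun_prop) (by fun_prop)]

theorem nnCharFun_dirac_zero (θ : ℝ) : nnCharFun (Measure.dirac 0) θ = 1 := by
  simp [nnCharFun_eq_integral]

theorem nnCharFun_conv (μ ν : Measure ℝ≥0) [IsFiniteMeasure μ] [IsFiniteMeasure ν] (θ : ℝ) :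
    nnCharFun (μ.conv ν) θ = nnCharFun μ θ * nnCharFun ν θ := by
  have hmap : (μ.conv ν).map ((↑) : ℝ≥0 → ℝ) =
      (μ.map ((↑) : ℝ≥0 → ℝ)).conv (ν.map ((↑) : ℝ≥0 → ℝ)) :=
    Measure.map_conv_addMonoidHom (NNReal.toRealHom : ℝ≥0 →+ ℝ) measurable_coe_nnreal_real
  rw [nnCharFun, hmap, charFun_conv, nnCharFun, nnCharFun]

theorem nnCharFun_sum_smul {ι : Type*} (s : Finset ι) {w : ι → ℝ} (hw : ∀ i ∈ s, 0 ≤ w i)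
    (μ : ι → Measure ℝ≥0) [∀ i, IsFiniteMeasure (μ i)] (θ : ℝ) :
    nnCharFun (∑ i ∈ s, ENNReal.ofReal (w i) • μ i) θ = ∑ i ∈ s, (w i : ℂ) * nnCharFun (μ i) θ := by
  simp only [nnCharFun_eq_integral]
  rw [integral_finsetSum_measure]
  · refine Finset.sum_congr rfl fun i hi => ?_
    rw [integral_smul_measure, ENNReal.toReal_ofReal (hw i hi), Complex.real_smul]
  · intro i _
    refine Integrable.smul_measure (Integrable.of_bound (by fun_prop) 1 (.of_forall fun x => ?_))
      ENNReal.ofReal_ne_top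
    rw [← Complex.ofReal_mul, Complex.norm_exp_ofReal_mul_I]

theorem measure_ext_of_nnCharFun {μ ν : Measure ℝ≥0} [IsFiniteMeasure μ] [IsFiniteMeasure ν]
    (h : ∀ θ, nnCharFun μ θ = nnCharFun ν θ) : μ = ν := by
  have hcoe : MeasurableEmbedding ((↑) : ℝ≥0 → ℝ) :=
    MeasurableEmbedding.subtype_coe measurableSet_Ici
  exact hcoe.map_injective (Measure.ext_of_charFun (funext h))

instance isFiniteMeasure_scaledLaw (H : Measure ℝ≥0) [IsFiniteMeasure H] (j : ℕ) :
    IsFiniteMeasure (scaledLaw H j) :=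
  inferInstanceAs (IsFiniteMeasure (H.map _))

theorem nnCharFun_scaledLaw (H : Measure ℝ≥0) (j : ℕ) (θ : ℝ) :
    nnCharFun (scaledLaw H j) θ = nnCharFun H (j * θ) := by
  rw [nnCharFun, scaledLaw, Measure.map_map (by fun_prop) (by fun_prop), nnCharFun,
    ← charFun_map_mul_comp (by fun_prop)]
  rfl

instance isFiniteMeasure_convPow (μ : Measure ℝ≥0) [IsFiniteMeasure μ] (m : ℕ) :
    IsFiniteMeasure (convPow μ m) := by
  induction m with
  | zero => exact inferInstanceAs (IsFiniteMeasure (Measure.dirac 0))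
  | succ m ih => exact inferInstanceAs (IsFiniteMeasure ((convPow μ m).conv μ))

theorem nnCharFun_convPow (μ : Measure ℝ≥0) [IsFiniteMeasure μ] (m : ℕ) (θ : ℝ) :
    nnCharFun (convPow μ m) θ = nnCharFun μ θ ^ m := by
  induction m with
  | zero => rw [convPow, nnCharFun_dirac_zero, pow_zero]
  | succ m ih => rw [convPow, nnCharFun_conv, ih, pow_succ]

theorem isFiniteMeasure_foldr_conv {l : List (Measure ℝ≥0)}
    (hl : ∀ μ ∈ l, IsFiniteMeasure μ) :
    IsFiniteMeasure (l.foldr Measure.conv (Measure.dirac 0)) :=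
  List.foldrRecOn l _ (inferInstanceAs (IsFiniteMeasure (Measure.dirac 0))) fun _ _ μ hμ => by
    have := hl μ hμ
    exact inferInstanceAs (IsFiniteMeasure (μ.conv _))

theorem nnCharFun_foldr_conv {l : List (Measure ℝ≥0)} (hl : ∀ μ ∈ l, IsFiniteMeasure μ)
    (θ : ℝ) :
    nnCharFun (l.foldr Measure.conv (Measure.dirac 0)) θ = (l.map (nnCharFun · θ)).prod := by
  induction l with
  | nil => exact nnCharFun_dirac_zero θ
  | cons μ l ih =>
    have hl' : ∀ ν ∈ l, IsFiniteMeasure ν := fun ν hν => hl ν (List.mem_cons_of_mem _ hν)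
    have := hl μ List.mem_cons_self
    have := isFiniteMeasure_foldr_conv hl'
    rw [List.foldr_cons, nnCharFun_conv, ih hl', List.map_cons, List.prod_cons]

variable (H : Measure ℝ≥0) [IsFiniteMeasure H] {n : ℕ} (v : Fin n → ℕ)

theorem isFiniteMeasure_of_mem_ofFn_convPow :
    ∀ μ ∈ List.ofFn fun j : Fin n => convPow (scaledLaw H (j + 1)) (v j),
      IsFiniteMeasure μ := by
  rintro _ hμ
  obtain ⟨j, rfl⟩ := List.mem_ofFn.1 hμ
  infer_instance

instance isFiniteMeasure_partitionConv : IsFiniteMeasure (partitionConv H v) :=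
  isFiniteMeasure_foldr_conv (isFiniteMeasure_of_mem_ofFn_convPow H v)

theorem nnCharFun_partitionConv (θ : ℝ) :
    nnCharFun (partitionConv H v) θ =
      ∏ j : Fin n, nnCharFun H ((j + 1 : ℕ) * θ) ^ v j := by
  rw [partitionConv, nnCharFun_foldr_conv (isFiniteMeasure_of_mem_ofFn_convPow H v),
    List.map_ofFn, List.prod_ofFn]
  simp only [Function.comp_apply, nnCharFun_convPow, nnCharFun_scaledLaw]

end CharFun

section AddingProcess

variable {Ω : Type*} {T : ℕ → Ω → ℝ≥0}

theorem addingProcess_mono (ω : Ω) : Monotone fun n => addingProcess T n ω :=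
  fun _ _ h => Finset.sum_le_sum_of_subset (Finset.range_mono h)

variable [MeasurableSpace Ω]

theorem measurable_addingProcess (hT : ∀ i, Measurable (T i)) (n : ℕ) :
    Measurable (addingProcess T n) :=
  Finset.measurable_sum (Finset.range n) fun i _ => hT i

/-- The weight of the cycle type `v` in the Ewens sampling formula: the probability that the
clusters of a sample of size `n` from a Dirichlet process with precision `α` comprise `v j` clusters
of size `j + 1`. -/
noncomputable def ewensWeight (α : ℝ) {n : ℕ} (v : Fin n → ℕ) : ℝ :=
  (n ! : ℝ) / risingFactorial α n *
    ∏ j : Fin n, α ^ v j / (((j : ℝ) + 1) ^ v j * ((v j)! : ℝ))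

theorem ewensWeight_nonneg {α : ℝ} (hα : 0 ≤ α) {n : ℕ} (v : Fin n → ℕ) : 0 ≤ ewensWeight α v := by
  have := risingFactorial_nonneg hα n
  exact mul_nonneg (by positivity) (Finset.prod_nonneg fun j _ => by positivity)

theorem nnCharFun_sum_ewensWeight_smul_partitionConv {α : ℝ} (hα : 0 ≤ α)
    (H : Measure ℝ≥0) [IsFiniteMeasure H] (n : ℕ) (θ : ℝ) :
    nnCharFun (∑ v ∈ partitionVectors n, ENNReal.ofReal (ewensWeight α v) • partitionConv H v) θ =
      (n ! : ℂ) / (risingFactorial α n : ℂ) * cycleIndex n fun j => α * nnCharFun H (j * θ) := by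
  rw [nnCharFun_sum_smul _ fun v _ => ewensWeight_nonneg hα v, cycleIndex, Finset.mul_sum]
  refine Finset.sum_congr rfl fun v _ => ?_
  rw [nnCharFun_partitionConv, ewensWeight]
  push_cast
  rw [mul_assoc, ← Finset.prod_mul_distrib]
  simp only [div_pow, mul_pow, div_div, mul_div_right_comm]

variable {P : Measure Ω} [IsFiniteMeasure P] {H : Measure ℝ≥0} [IsProbabilityMeasure H] {α : ℝ}
  {F : Ω → ProbabilityMeasure ℝ≥0}

theorem nnCharFun_map_addingProcess (hα : 0 < α) (hF : IsDirichletProcess F α H P)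
    (hT : IsCondIID T F P) (n : ℕ) (θ : ℝ) :
    nnCharFun (P.map (addingProcess T n)) θ =
      (n ! : ℂ) / (risingFactorial α n : ℂ) * cycleIndex n fun j => α * nnCharFun H (j * θ) := by
  let f : ℝ≥0 → ℂ := fun x => Complex.exp (θ * (x : ℝ) * Complex.I)
  have hf : StronglyMeasurable f := Measurable.stronglyMeasurable (by fun_prop)
  have hnorm (x : ℝ≥0) : ‖f x‖ = 1 := by
    simp only [f, ← Complex.ofReal_mul, Complex.norm_exp_ofReal_mul_I]
  have hprod (ω : Ω) : f (addingProcess T n ω) = ∏ i : Fin n, f (T i ω) := by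
    simp only [f, ← Complex.exp_sum, addingProcess, Finset.sum_range, ← Finset.sum_mul,
      ← Finset.mul_sum, NNReal.coe_sum, Complex.ofReal_sum]
  have hpow (j : ℕ) : ∫ x, f x ^ j ∂H = nnCharFun H (j * θ) := by
    simp only [nnCharFun_eq_integral, f, ← Complex.exp_nat_mul]
    push_cast
    simp only [mul_assoc]
  have hintegrable : Integrable (fun ω => ∏ i : Fin n, f (T i ω)) P :=
    .of_bound (Finset.measurable_prod Finset.univ fun (i : Fin n) _ =>
      hf.measurable.comp (hT.measurable i)).aestronglyMeasurable 1
        (.of_forall fun ω => by simp [norm_prod, hnorm])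
  calc nnCharFun (P.map (addingProcess T n)) θ
      = ∫ ω, ∏ i : Fin n, f (T i ω) ∂P := by
        rw [nnCharFun_eq_integral, integral_map
          (measurable_addingProcess hT.measurable n).aemeasurable hf.aestronglyMeasurable]
        exact integral_congr_ae (.of_forall hprod)
    _ = ∫ ω, (∫ x, f x ∂(F ω : Measure ℝ≥0)) ^ n ∂P := by
        rw [hT.integral_prod hF.measurable (fun _ => hf) hintegrable]
        simp only [Finset.prod_const, Finset.card_univ, Fintype.card_fin]
    _ = _ := by
        rw [hF.integral_integral_pow hα hf (fun x => (hnorm x).le)]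
        simp only [hpow]
        rfl

theorem map_addingProcess (hα : 0 < α) (hF : IsDirichletProcess F α H P) (hT : IsCondIID T F P)
    (n : ℕ) :
    P.map (addingProcess T n) =
      ∑ v ∈ partitionVectors n, ENNReal.ofReal (ewensWeight α v) • partitionConv H v := by
  have (v : Fin n → ℕ) : IsFiniteMeasure (ENNReal.ofReal (ewensWeight α v) • partitionConv H v) :=
    Measure.smul_finite _ ENNReal.ofReal_ne_top
  refine measure_ext_of_nnCharFun fun θ => ?_
  rw [nnCharFun_map_addingProcess hα hF hT, nnCharFun_sum_ewensWeight_smul_partitionConv hα.le]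

theorem measureReal_addingProcess_le (hα : 0 < α) (hF : IsDirichletProcess F α H P)
    (hT : IsCondIID T F P) (n : ℕ) (t : ℝ≥0) :
    P.real {ω | addingProcess T n ω ≤ t} =
      ∑ v ∈ partitionVectors n, ewensWeight α v * (partitionConv H v).real (Set.Iic t) := by
  change P.real (addingProcess T n ⁻¹' Set.Iic t) = _
  rw [← map_measureReal_apply (measurable_addingProcess hT.measurable n) measurableSet_Iic,
    map_addingProcess hα hF hT, measureReal_def, Measure.finsetSum_apply, ENNReal.toReal_sum]
  · simp only [Measure.smul_apply, smul_eq_mul, ENNReal.toReal_mul,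
      ENNReal.toReal_ofReal (ewensWeight_nonneg hα.le _), measureReal_def]
  · exact fun v _ => ENNReal.mul_ne_top ENNReal.ofReal_ne_top (measure_ne_top _ _)

end AddingProcess

section Renewal

theorem sSup_natCast_image_eq_encard {s : Set ℕ} (hs : IsLowerSet s) (h0 : 0 ∈ s) :
    sSup ((↑) '' s : Set ℕ∞) = {m : ℕ | m + 1 ∈ s}.encard := by
  rcases hs.eq_univ_or_Iio with rfl | ⟨N, rfl⟩
  · rw [ENat.sSup_eq_top_of_infinite (Set.infinite_univ.image Nat.cast_injective.injOn)]
    simp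
  · obtain ⟨N, rfl⟩ := Nat.exists_eq_succ_of_ne_zero (Set.mem_Iio.1 h0).ne'
    have hmax : IsGreatest ((↑) '' Set.Iio N.succ : Set ℕ∞) N :=
      ⟨⟨N, N.lt_succ_self, rfl⟩,
        Set.forall_mem_image.2 fun _ hm => Nat.cast_le.2 (Nat.lt_succ_iff.1 hm)⟩
    have hcount : {m : ℕ | m + 1 ∈ Set.Iio N.succ} = Finset.range N := by
      ext
      simp
    rw [hmax.isLUB.sSup_eq, hcount, Set.encard_coe_eq_coe_finsetCard, Finset.card_range]

variable {Ω : Type*} {T : ℕ → Ω → ℝ≥0}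

theorem mixedRenewalProcess_eq_encard (t : ℝ≥0) (ω : Ω) :
    mixedRenewalProcess T t ω = {m : ℕ | addingProcess T (m + 1) ω ≤ t}.encard := by
  have himage : {m : ℕ∞ | ∃ n : ℕ, m = n ∧ addingProcess T n ω ≤ t} =
      (↑) '' {n : ℕ | addingProcess T n ω ≤ t} := by
    ext m
    simp only [Set.mem_ofPred_eq, Set.mem_image, and_comm, eq_comm]
  rw [mixedRenewalProcess, himage, sSup_natCast_image_eq_encard]
  · rfl
  · exact fun m n hnm hm => (addingProcess_mono ω hnm).trans hm
  · simp [addingProcess]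

theorem mixedRenewalFunction_eq_tsum [MeasurableSpace Ω] (P : Measure Ω)
    (hT : ∀ i, Measurable (T i)) (t : ℝ≥0) :
    mixedRenewalFunction P T t = ∑' m : ℕ, P {ω | addingProcess T (m + 1) ω ≤ t} := by
  have hmeas (m : ℕ) : MeasurableSet {ω | addingProcess T (m + 1) ω ≤ t} :=
    measurable_addingProcess hT (m + 1) measurableSet_Iic
  have hcount (ω : Ω) : (mixedRenewalProcess T t ω : ℝ≥0∞) =
      ∑' m : ℕ, {ω | addingProcess T (m + 1) ω ≤ t}.indicator 1 ω := by
    rw [mixedRenewalProcess_eq_encard, ← ENNReal.tsum_set_one,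
      tsum_subtype {m | addingProcess T (m + 1) ω ≤ t} fun _ => (1 : ℝ≥0∞)]
    rfl
  simp only [mixedRenewalFunction, hcount]
  rw [lintegral_tsum fun m => (measurable_one.indicator (hmeas m)).aemeasurable]
  simp only [lintegral_indicator_one (hmeas _)]

end Renewal

theorem mainTheorem6 {Ω : Type*} [MeasurableSpace Ω] (P : Measure Ω) [IsProbabilityMeasure P]
    (α : ℝ) (hα : 0 < α) (H : Measure ℝ≥0) [IsProbabilityMeasure H]
    (F : Ω → ProbabilityMeasure ℝ≥0) (hF : IsDirichletProcess F α H P)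
    (T : ℕ → Ω → ℝ≥0) (hT : IsCondIID T F P) :
    (∀ (n : ℕ) (t : ℝ≥0),
      P.real {ω | addingProcess T n ω ≤ t} =
        (n ! : ℝ) / risingFactorial α n *
          ∑ v ∈ partitionVectors n,
            (∏ j : Fin n, α ^ v j / (((j : ℝ) + 1) ^ v j * ((v j)! : ℝ))) *
              (partitionConv H v).real (Set.Iic t)) ∧
    (∀ t : ℝ≥0,
      mixedRenewalFunction P T t =
        ∑' m : ℕ, ENNReal.ofReal
          (((m + 1)! : ℝ) / risingFactorial α (m + 1) *
            ∑ v ∈ partitionVectors (m + 1),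
              (∏ j : Fin (m + 1), α ^ v j / (((j : ℝ) + 1) ^ v j * ((v j)! : ℝ))) *
                (partitionConv H v).real (Set.Iic t))) := by
  have hcdf (n : ℕ) (t : ℝ≥0) : P.real {ω | addingProcess T n ω ≤ t} =
      (n ! : ℝ) / risingFactorial α n * ∑ v ∈ partitionVectors n,
        (∏ j : Fin n, α ^ v j / (((j : ℝ) + 1) ^ v j * ((v j)! : ℝ))) *
          (partitionConv H v).real (Set.Iic t) := by
    rw [measureReal_addingProcess_le hα hF hT]
    simp only [ewensWeight, Finset.mul_sum, mul_assoc]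
  refine ⟨hcdf, fun t => ?_⟩
  rw [mixedRenewalFunction_eq_tsum P hT.measurable]
  exact tsum_congr fun m => by rw [← hcdf, ofReal_measureReal]
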